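/- Let $p$ be a prime number, let $K$ be a field with $\operatorname{char} K = p$, let $r$ be a positive integer, and let $G = (\mathbb{Z}/p\mathbb{Z})^r$. Let $G \to GL(V)$ be any faithful finite-dimensional representation of $G$ over $K$, and let $G$ act accordingly on the function field $K(V)$, the field of fractions of the symmetric algebra of the dual space $V^*$. A faithful $G$-subfield of $K(V)$ is a field $E$ with $K \subseteq E \subseteq K(V)$ which is stable under $G$ and on which $G$ acts faithfully. The essential dimension $\mathrm{ed}_K(G)$, computed from $V$, is the minimum of the transcendence degrees $\operatorname{trdeg}_K E$ over all faithful $G$-subfields $E$ of $K(V)$. Then, whichever faithful representation $V$ is used, $$\mathrm{ed}_K\big((\mathbb{Z}/p\mathbb{Z})^r\big) = 1 \quad\text{if and only if}\quad [K:\mathbb{F}_p] \ge r,$$ where $[K:\mathbb{F}_p]$ is the (possibly infinite) dimension of $K$ as a vector space over $\mathbb{F}_p$. -/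

import Mathlib

/-- The function field `K(V)` of a `K`-vector space `V`: the field of fractions of the algebra
`Sym(V*)` of polynomial functions on `V`. -/
abbrev RationalFunctionField (K V : Type*) [Field K] [AddCommGroup V] [Module K V] : Type _ :=
  FractionRing (SymmetricAlgebra K (Module.Dual K V))

/-- The action of `G` on `Sym(V*)` by `K`-algebra automorphisms induced by a representation of `G`
on `V`: it extends the contragredient action `(g • f) v = f (g⁻¹ • v)` on linear forms. -/
noncomputable def polyAction {K G V : Type*} [Field K] [Group G] [AddCommGroup V] [Module K V]
    (ρ : Representation K G V) :
    G →* (SymmetricAlgebra K (Module.Dual K V) ≃ₐ[K] SymmetricAlgebra K (Module.Dual K V)) :=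
  (AlgEquiv.algHomUnitsEquiv K (SymmetricAlgebra K (Module.Dual K V))).toMonoidHom.comp
    (MonoidHom.toHomUnits
      { toFun := fun g => SymmetricAlgebra.lift (SymmetricAlgebra.ι K _ ∘ₗ ρ.dual g)
        map_one' := by
          apply SymmetricAlgebra.algHom_ext
          ext f
          rw [map_one]
          simp
        map_mul' := fun g h => by
          apply SymmetricAlgebra.algHom_ext
          ext f
          rw [map_mul]
          simp [-Representation.dual_apply, Module.End.mul_apply] })

/-- The action of `G` on the function field `K(V)` by `K`-automorphisms induced by a representation
of `G` on `V`. -/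
noncomputable def functionFieldAction {K G V : Type*} [Field K] [Group G] [AddCommGroup V]
    [Module K V] (ρ : Representation K G V) :
    G →* (RationalFunctionField K V ≃ₐ[K] RationalFunctionField K V) :=
  (IsFractionRing.fieldEquivOfAlgEquivHom K (RationalFunctionField K V)).comp (polyAction ρ)

/-- Let `G` act on a field `L` by `K`-automorphisms. An intermediate field `E` of `L / K` is a
faithful `G`-subfield if it is stable under `G` and the induced homomorphism `G → Aut_K(E)` is
injective, that is, only `1 : G` fixes every element of `E`. -/
def IsFaithfulGSubfield {K G L : Type*} [Field K] [Group G] [Field L] [Algebra K L]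
    (σ : G →* (L ≃ₐ[K] L)) (E : IntermediateField K L) : Prop :=
  (∀ g : G, ∀ x ∈ E, σ g x ∈ E) ∧ ∀ g : G, (∀ x ∈ E, σ g x = x) → g = 1

/-- The essential dimension `ed_K(G)`, computed from a faithful finite-dimensional representation
`ρ` of `G` on `V`: the minimum of `trdeg_K E` over all faithful `G`-subfields `E` of `K(V)`.
For faithful `ρ` the set below contains the transcendence degree of `K(V)` itself, so it is
nonempty and the infimum of cardinals is attained. -/
noncomputable def essentialDimension {K G V : Type*} [Field K] [Group G] [AddCommGroup V]
    [Module K V] (ρ : Representation K G V) : Cardinal :=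
  sInf {d | ∃ E : IntermediateField K (RationalFunctionField K V),
    IsFaithfulGSubfield (functionFieldAction ρ) E ∧ d = Algebra.trdeg K E}

/-! Nontrivial faithful subfields have transcendence degree at least 1, because `K` is algebraically
closed in `K(V)`. If `[K : 𝔽_p] ≥ r`, an injective additive map `c : G → K` exists; additive Hilbert
90 gives `f` with `g f = f + c g`, and `K(f)` is faithful of degree 1 (`essentialDimension_eq_one`).
Conversely, suppose the value is 1 and `[K : 𝔽_p] = m < r`, so that `K` is finite. A faithful
subfield of degree 1 may be taken finitely generated; specialization embeds it in `K(X)` and Lüroth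
makes it isomorphic to `K(X)`. There `G` acts freely on the `GL₂(K)`-orbit of `X`, so `p ^ r`
divides `|GL₂(K)|`, whose `p`-part is `p ^ m`: a contradiction. -/

/-! ### Specialization of function fields to `K(X)` -/

open Polynomial in
/-- The Kronecker substitution `X i ↦ X ^ (N ^ i)` is injective on polynomials all of whose
exponents are smaller than `N`. -/
lemma MvPolynomial.eq_zero_of_aeval_X_pow_eq_zero {K : Type*} [CommRing K] {n N : ℕ}
    {x : MvPolynomial (Fin n) K} (hx : ∀ s ∈ x.support, ∀ i, s i < N)
    (h : MvPolynomial.aeval (fun i : Fin n => (Polynomial.X : K[X]) ^ (N ^ (i : ℕ))) x = 0) :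
    x = 0 := by
  classical
  -- Exponents below `N` are base-`N` digits, so distinct monomials go to distinct powers of `X`.
  have key : ∀ s ∈ x.support, ∀ t ∈ x.support,
      ∑ i : Fin n, s i * N ^ (i : ℕ) = ∑ i : Fin n, t i * N ^ (i : ℕ) → s = t := by
    intro s hs t ht hst
    have := @finFunctionFinEquiv_apply N n (fun i => ⟨s i, hx s hs i⟩)
    have h2 := @finFunctionFinEquiv_apply N n (fun i => ⟨t i, hx t ht i⟩)
    have h3 := finFunctionFinEquiv.injective (Fin.ext ((this.trans hst).trans h2.symm))
    ext i
    simpa using congrFun h3 i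
  have expand : MvPolynomial.aeval (fun i : Fin n => (Polynomial.X : K[X]) ^ (N ^ (i : ℕ))) x =
      ∑ s ∈ x.support, Polynomial.monomial (∑ i : Fin n, s i * N ^ (i : ℕ)) (x.coeff s) := by
    rw [MvPolynomial.aeval_def, MvPolynomial.eval₂_eq']
    refine Finset.sum_congr rfl fun s _ => ?_
    rw [← Polynomial.C_mul_X_pow_eq_monomial, ← Finset.prod_pow_eq_pow_sum]
    congr 1
    refine Finset.prod_congr rfl fun i _ => ?_
    rw [← pow_mul, mul_comm]
  by_contra hne
  obtain ⟨s, hs⟩ := (MvPolynomial.support_nonempty (p := x)).mpr hne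
  have hc := congrArg (Polynomial.coeff · (∑ i : Fin n, s i * N ^ (i : ℕ))) (expand.symm.trans h)
  simp only [Polynomial.finsetSum_coeff, Polynomial.coeff_monomial, Polynomial.coeff_zero] at hc
  rw [Finset.sum_eq_single s (fun t ht hts => if_neg fun e => hts (key t ht s hs e))
    (fun hs' => (hs' hs).elim), if_pos rfl] at hc
  exact (MvPolynomial.mem_support_iff.mp hs) hc

-- Powers of `X` replace values in `K`, which may be too small a field for generic specialization.
open Polynomial in
lemma MvPolynomial.exists_algHom_injective_on_span {K : Type*} [CommRing K] {n : ℕ}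
    (T : Finset (MvPolynomial (Fin n) K)) :
    ∃ ψ : MvPolynomial (Fin n) K →ₐ[K] K[X],
      ∀ x ∈ Submodule.span K (T : Set (MvPolynomial (Fin n) K)), ψ x = 0 → x = 0 := by
  obtain ⟨N, hN⟩ : ∃ N, N = T.sup MvPolynomial.totalDegree + 1 := ⟨_, rfl⟩
  refine ⟨MvPolynomial.aeval fun i : Fin n => (Polynomial.X : K[X]) ^ (N ^ (i : ℕ)), fun x hx h => ?_⟩
  refine MvPolynomial.eq_zero_of_aeval_X_pow_eq_zero (N := N) (fun s hs i => ?_) h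
  have hle : Submodule.span K (T : Set (MvPolynomial (Fin n) K)) ≤
      MvPolynomial.restrictTotalDegree (Fin n) K (T.sup MvPolynomial.totalDegree) :=
    Submodule.span_le.mpr fun y hy => by
      rw [SetLike.mem_coe, MvPolynomial.mem_restrictTotalDegree]
      exact Finset.le_sup (f := MvPolynomial.totalDegree) (Finset.mem_coe.mp hy)
  have h1 := (MvPolynomial.mem_restrictTotalDegree _ _ _).mp (hle hx)
  have h2 := MvPolynomial.le_totalDegree hs
  have h3 : s i ≤ s.sum fun _ e => e := by
    rw [Finsupp.sum_fintype _ _ (fun _ => rfl)]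
    exact Finset.single_le_sum (f := fun i => s i) (fun _ _ => Nat.zero_le _) (Finset.mem_univ i)
  omega

open Polynomial in
lemma SymmetricAlgebra.exists_algHom_injective_on_span {K M : Type*} [Field K] [AddCommGroup M]
    [Module K M] [FiniteDimensional K M] (T : Finset (SymmetricAlgebra K M)) :
    ∃ ψ : SymmetricAlgebra K M →ₐ[K] K[X],
      ∀ x ∈ Submodule.span K (T : Set (SymmetricAlgebra K M)), ψ x = 0 → x = 0 := by
  classical
  let e := SymmetricAlgebra.equivMvPolynomial (Module.finBasis K M)
  obtain ⟨ψ, hψ⟩ := MvPolynomial.exists_algHom_injective_on_span (T.image e)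
  refine ⟨ψ.comp e.toAlgHom, fun x hx h => ?_⟩
  refine (map_eq_zero_iff e e.injective).mp (hψ (e x) ?_ h)
  rw [Finset.coe_image, show (e '' (T : Set (SymmetricAlgebra K M))) =
    e.toLinearMap '' (T : Set (SymmetricAlgebra K M)) from rfl, Submodule.span_image]
  exact Submodule.mem_map_of_mem hx

open Polynomial in
/-- Let `L` be the field of fractions of a `K`-algebra `A` that has enough specializations to
`K[X]`. Then finitely many elements of `L` can be specialized to `K(X)` in such a way that a given
nonconstant element stays transcendental. -/
lemma exists_specialization {K A L : Type*} [Field K] [CommRing A] [IsDomain A] [Algebra K A]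
    [Field L] [Algebra A L] [Algebra K L] [IsScalarTower K A L] [IsFractionRing A L]
    (hA : ∀ T : Finset A, ∃ ψ : A →ₐ[K] K[X],
      ∀ x ∈ Submodule.span K (T : Set A), ψ x = 0 → x = 0)
    (S : Finset L) (f : L) (hf : f ∉ (⊥ : IntermediateField K L)) :
    ∃ B : Subalgebra K L, (S : Set L) ⊆ B ∧ ∃ hfB : f ∈ B, ∃ φ : B →ₐ[K] RatFunc K,
      Transcendental K (φ ⟨f, hfB⟩) := by
  classical
  obtain ⟨b, hb⟩ := IsLocalization.exist_integer_multiples_of_finset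
    (nonZeroDivisors A) (insert f S)
  obtain ⟨u, hu⟩ := hb f (Finset.mem_insert_self _ _)
  -- Here `f = u / b`. Injectivity on the span of `u` and `b` keeps `ψ b ≠ 0`, and `ψ u = c ψ b`
  -- would force `f = c`.
  obtain ⟨ψ, hψ⟩ := hA {u, (b : A)}
  have hb0 : (b : A) ≠ 0 := nonZeroDivisors.ne_zero b.2
  have hb0' : algebraMap A L b ≠ 0 := by
    simp
  have hψb : ψ b ≠ 0 := fun h => hb0 (hψ _ (Submodule.subset_span (by simp)) h)
  have hprime : (RingHom.ker ψ).IsPrime := RingHom.ker_isPrime _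
  let M : Submonoid A := (RingHom.ker ψ).primeCompl
  have hbM : (b : A) ∈ M := fun h => hψb h
  have hM : M ≤ nonZeroDivisors A := fun x hx =>
    mem_nonZeroDivisors_of_ne_zero fun h => hx (by simp [h])
  -- The local ring at `ker ψ`; it contains every fraction with denominator `b`.
  let B := Localization.subalgebra.ofField L M hM
  have hmem : ∀ a : A, algebraMap A L a / algebraMap A L b ∈ B := fun a => by
    exact ⟨a, b, hbM, div_eq_mul_inv _ _⟩
  have hint : ∀ x : L, IsLocalization.IsInteger A ((b : A) • x) → x ∈ B := by
    rintro x ⟨a, ha⟩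
    rw [Algebra.smul_def] at ha
    rw [← mul_div_cancel_left₀ x hb0', ← ha]
    exact hmem a
  have hfB : f ∈ B := hint f (hb f (Finset.mem_insert_self _ _))
  let ψ' : A →ₐ[K] RatFunc K := (IsScalarTower.toAlgHom K K[X] (RatFunc K)).comp ψ
  have hψ' : ∀ x, ψ' x = 0 → ψ x = 0 := fun x hx => by
    simpa [ψ'] using hx
  have hunit : ∀ y : M, IsUnit (ψ' y) := fun y => isUnit_iff_ne_zero.mpr fun h => y.2 (hψ' _ h)
  let φ : B →ₐ[K] RatFunc K := IsLocalization.liftAlgHom (M := M) (f := ψ') hunit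
  refine ⟨B.restrictScalars K, fun x hx => hint x (hb x (Finset.mem_insert_of_mem hx)), hfB, φ, ?_⟩
  refine RatFunc.transcendental_of_ne_C _ ?_
  rintro ⟨c, hc⟩
  have hφ : ∀ a : A, φ (algebraMap A B a) = ψ' a := fun a => IsLocalization.lift_eq hunit a
  have hmul : (⟨f, hfB⟩ : B) * algebraMap A B b = algebraMap A B u := by
    apply Subtype.ext
    change f * algebraMap A L b = algebraMap A L u
    rw [hu, Algebra.smul_def, mul_comm]
  have h1 := congrArg φ hmul
  rw [map_mul, hφ, hφ] at h1
  have h2 : ψ' (u - c • (b : A)) = 0 := by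
    rw [map_sub, map_smul, ← h1, sub_eq_zero, Algebra.smul_def]
    exact congrArg (· * ψ' b) hc
  have h3 := hψ _ (Submodule.sub_mem _ (Submodule.subset_span (by simp))
    (Submodule.smul_mem _ c (Submodule.subset_span (by simp)))) (hψ' _ h2)
  apply hf
  rw [IntermediateField.mem_bot]
  refine ⟨c, mul_right_cancel₀ hb0' ?_⟩
  rw [sub_eq_zero] at h3
  rw [mul_comm f, ← Algebra.smul_def (b : A) f]
  change _ = (b : A) • f at hu
  rw [← hu, h3, Algebra.smul_def, map_mul, ← IsScalarTower.algebraMap_apply]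

/-- The constants are algebraically closed in the field of rational functions. -/
lemma mem_bot_of_isAlgebraic {K V : Type*} [Field K] [AddCommGroup V] [Module K V]
    [FiniteDimensional K V] {x : RationalFunctionField K V} (hx : IsAlgebraic K x) :
    x ∈ (⊥ : IntermediateField K (RationalFunctionField K V)) := by
  by_contra h
  obtain ⟨B, -, hxB, φ, hφ⟩ := exists_specialization
    (A := SymmetricAlgebra K (Module.Dual K V))
    SymmetricAlgebra.exists_algHom_injective_on_span ∅ x h
  refine hφ (IsAlgebraic.algHom φ ?_)
  exact (isAlgebraic_algHom_iff B.val Subtype.val_injective).mp hx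

/-- A nonzero `x` in the kernel is algebraic over `K[f]`, so it divides some nonzero `P(f)`; then
`P(φ f) = 0`, against transcendence. -/
lemma AlgHom.injective_of_trdeg_le_one {K A C : Type*} [Field K] [CommRing A] [IsDomain A]
    [Algebra K A] [CommRing C] [IsDomain C] [Algebra K C] (hA : Algebra.trdeg K A ≤ 1)
    (φ : A →ₐ[K] C) (f : A) (hf : Transcendental K (φ f)) : Function.Injective φ := by
  rw [injective_iff_map_eq_zero]
  intro x hx
  by_contra hne
  have hft : Transcendental K f := fun h => hf (h.algHom φ)
  have hind : AlgebraicIndependent K (fun _ : Unit => f) :=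
    algebraicIndependent_unique_type_iff.mpr hft
  have hb := hind.isTranscendenceBasis_of_lift_trdeg_le_of_finite (by simpa using hA)
  have hx' := hb.isAlgebraic.isAlgebraic x
  obtain ⟨⟨r, hr⟩, hr0, d, hd⟩ := hx'.exists_nonzero_dvd (mem_nonZeroDivisors_of_ne_zero hne)
  rw [Set.range_const, Algebra.adjoin_singleton_eq_range_aeval] at hr
  obtain ⟨P, rfl⟩ := hr
  have hd' : Polynomial.aeval f P = x * d := hd
  have : Polynomial.aeval (φ f) P = 0 := by
    rw [Polynomial.aeval_algHom_apply, hd', map_mul, hx, zero_mul]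
  have hP : P = 0 := (transcendental_iff.mp hf) P this
  subst hP
  exact hr0 (Subtype.ext (by simp))

open scoped IntermediateField.algebraAdjoinAdjoin in
/-- A finitely generated nontrivial subfield of transcendence degree at most one of a field of
rational functions embeds into `K(X)`. -/
lemma nonempty_algHom_ratFunc {K V : Type*} [Field K] [AddCommGroup V] [Module K V]
    [FiniteDimensional K V] (S : Finset (RationalFunctionField K V))
    (hS : IntermediateField.adjoin K (S : Set (RationalFunctionField K V)) ≠ ⊥)
    (htr : Algebra.trdeg K
      (IntermediateField.adjoin K (S : Set (RationalFunctionField K V))) ≤ 1) :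
    Nonempty (IntermediateField.adjoin K (S : Set (RationalFunctionField K V)) →ₐ[K]
      RatFunc K) := by
  obtain ⟨f, hfS, hf⟩ : ∃ f ∈ S, f ∉ (⊥ : IntermediateField K (RationalFunctionField K V)) := by
    by_contra! h
    exact hS (le_bot_iff.mp (IntermediateField.adjoin_le_iff.mpr h))
  obtain ⟨B, hSB, hfB, φ, hφ⟩ := exists_specialization
    (A := SymmetricAlgebra K (Module.Dual K V))
    SymmetricAlgebra.exists_algHom_injective_on_span S f hf
  let A := Algebra.adjoin K (S : Set (RationalFunctionField K V))
  have hAB : A ≤ B := Algebra.adjoin_le hSB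
  let φA : A →ₐ[K] RatFunc K := φ.comp (Subalgebra.inclusion hAB)
  have hfA : f ∈ A := Algebra.subset_adjoin hfS
  let j : A →ₐ[K] IntermediateField.adjoin K (S : Set (RationalFunctionField K V)) :=
    Subalgebra.inclusion (IntermediateField.algebra_adjoin_le_adjoin K _)
  have hA : Algebra.trdeg K A ≤ 1 :=
    (trdeg_le_of_injective j (Subalgebra.inclusion_injective _)).trans htr
  have hinj : Function.Injective φA := φA.injective_of_trdeg_le_one hA ⟨f, hfA⟩ hφ
  exact ⟨IsFractionRing.liftAlgHom (A := A) hinj⟩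

/-! ### Finite groups acting on `K(X)` -/

lemma RatFunc.algEquiv_eq_one_of_apply_X {K : Type*} [Field K]
    {σ : RatFunc K ≃ₐ[K] RatFunc K} (h : σ RatFunc.X = RatFunc.X) : σ = 1 := by
  have hp : ∀ p : Polynomial K,
      σ (algebraMap (Polynomial K) (RatFunc K) p) = algebraMap (Polynomial K) (RatFunc K) p := by
    intro p
    have : (σ.toAlgHom.comp (IsScalarTower.toAlgHom K (Polynomial K) (RatFunc K))) =
        IsScalarTower.toAlgHom K (Polynomial K) (RatFunc K) := by
      apply Polynomial.algHom_ext
      simpa using h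
    exact DFunLike.congr_fun this p
  ext y
  obtain ⟨p, q, -, rfl⟩ := IsFractionRing.div_surjective (Polynomial K) y
  rw [map_div₀, hp, hp, AlgEquiv.one_apply]

/-- An automorphism of `K(X)` sends `X` to its image under a Möbius transformation. -/
lemma RatFunc.exists_algEquiv_X_eq_smul {K : Type*} [Field K] [DecidableEq (RatFunc K)]
    (σ : RatFunc K ≃ₐ[K] RatFunc K) :
    ∃ g : GL (Fin 2) K, ((σ RatFunc.X : RatFunc K) : OnePoint (RatFunc K)) =
      g.map (algebraMap K (RatFunc K)) • ((RatFunc.X : RatFunc K) : OnePoint (RatFunc K)) := by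
  obtain ⟨y, hy⟩ : ∃ y, y = σ RatFunc.X := ⟨_, rfl⟩
  have htop : IntermediateField.adjoin K {y} = ⊤ := by
    have h := IntermediateField.adjoin_map K {(RatFunc.X : RatFunc K)} σ.toAlgHom
    rw [RatFunc.adjoin_X, Set.image_singleton] at h
    rw [hy]
    refine h.symm.trans (eq_top_iff.mpr fun z _ => ?_)
    exact ⟨σ.symm z, trivial, σ.apply_symm_apply z⟩
  -- Since `K(y) = K(X)`, numerator and denominator of `y` have maximal degree exactly 1.
  have hdeg := y.finrank_eq_max_natDegree
  rw [htop, IntermediateField.finrank_top] at hdeg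
  have hnum := Polynomial.eq_X_add_C_of_natDegree_le_one
    (hdeg ▸ le_max_left _ _ : y.num.natDegree ≤ 1)
  have hden := Polynomial.eq_X_add_C_of_natDegree_le_one
    (hdeg ▸ le_max_right _ _ : y.denom.natDegree ≤ 1)
  have hconst : ¬ ∃ k, y = RatFunc.C k := by
    rw [RatFunc.eq_C_iff]
    rintro ⟨h1, h2⟩
    rw [h1, h2] at hdeg
    simp at hdeg
  obtain ⟨a, ha⟩ : ∃ a, a = y.num.coeff 1 := ⟨_, rfl⟩
  obtain ⟨b, hb⟩ : ∃ b, b = y.num.coeff 0 := ⟨_, rfl⟩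
  obtain ⟨c, hc⟩ : ∃ c, c = y.denom.coeff 1 := ⟨_, rfl⟩
  obtain ⟨d, hd⟩ : ∃ d, d = y.denom.coeff 0 := ⟨_, rfl⟩
  rw [← ha, ← hb] at hnum
  rw [← hc, ← hd] at hden
  have hyeq : y = (RatFunc.C a * RatFunc.X + RatFunc.C b) /
      (RatFunc.C c * RatFunc.X + RatFunc.C d) := by
    conv_lhs => rw [← RatFunc.num_div_denom y, hnum, hden]
    simp
  have hden0 : RatFunc.C c * RatFunc.X + RatFunc.C d ≠ 0 := by
    have := RatFunc.algebraMap_ne_zero (K := K) y.denom_ne_zero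
    rw [hden] at this
    simpa using this
  have hdet : a * d - b * c ≠ 0 := by
    intro h
    have h' : RatFunc.C a * RatFunc.C d = RatFunc.C b * (RatFunc.C c : RatFunc K) := by
      rw [← map_mul, ← map_mul, sub_eq_zero.mp h]
    apply hconst
    by_cases hc0 : c = 0
    · have hd0 : (RatFunc.C d : RatFunc K) ≠ 0 := by
        rintro hd0
        simp [hc0, hd0] at hden0
      refine ⟨b / d, ?_⟩
      rw [hyeq, map_div₀, div_eq_div_iff hden0 hd0]
      linear_combination RatFunc.X * h'
    · have hc0' : (RatFunc.C c : RatFunc K) ≠ 0 := by simpa using hc0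
      refine ⟨a / c, ?_⟩
      rw [hyeq, map_div₀, div_eq_div_iff hden0 hc0']
      linear_combination - h'
  refine ⟨Matrix.GeneralLinearGroup.mkOfDetNeZero !![a, b; c, d]
    (by rwa [Matrix.det_fin_two_of]), ?_⟩
  rw [OnePoint.smul_some_eq_ite, ← hy]
  refine Eq.trans ?_ (if_neg hden0).symm
  exact congrArg _ hyeq

/-- Automorphisms of `K(X)` act freely on the orbit of `X` under Möbius transformations over `K`. -/
lemma RatFunc.card_dvd_card_GL_two {K G : Type*} [Field K] [Finite K] [Group G] [Finite G]
    (τ : G →* (RatFunc K ≃ₐ[K] RatFunc K)) (hτ : Function.Injective τ) :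
    Nat.card G ∣ Nat.card (GL (Fin 2) K) := by
  classical
  let x₀ : OnePoint (RatFunc K) := ((RatFunc.X : RatFunc K) : OnePoint (RatFunc K))
  let : MulAction (GL (Fin 2) K) (OnePoint (RatFunc K)) :=
    MulAction.compHom _ (Matrix.GeneralLinearGroup.map (algebraMap K (RatFunc K)))
  have hsmul : ∀ (g : GL (Fin 2) K) (x : OnePoint (RatFunc K)),
      g • x = g.map (algebraMap K (RatFunc K)) • x := fun _ _ => rfl
  -- Automorphisms over `K` fix the matrix entries, so they commute with Möbius maps and preserve
  -- the orbit of `X`.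
  have hcomm : ∀ (s : G) (g : GL (Fin 2) K) (x : OnePoint (RatFunc K)),
      OnePoint.map (τ s) (g • x) = g • OnePoint.map (τ s) x := by
    intro s g x
    rw [hsmul, hsmul]
    have := OnePoint.map_smul ((τ s : RatFunc K ≃ₐ[K] RatFunc K) : RatFunc K →+* RatFunc K)
      (g.map (algebraMap K (RatFunc K))) x
    refine this.trans ?_
    congr 1
    ext i j
    exact (τ s).commutes (g i j)
  have hx₀ : ∀ s : G, OnePoint.map (τ s) x₀ ∈ MulAction.orbit (GL (Fin 2) K) x₀ := by
    intro s
    obtain ⟨g, hg⟩ := RatFunc.exists_algEquiv_X_eq_smul (τ s)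
    exact ⟨g, hg.symm⟩
  let : MulAction G (MulAction.orbit (GL (Fin 2) K) x₀) :=
    { smul := fun s x => ⟨OnePoint.map (τ s) x.1, by
        obtain ⟨_, g, rfl⟩ := x
        change OnePoint.map (τ s) (g • x₀) ∈ _
        rw [hcomm]
        obtain ⟨k, hk⟩ := hx₀ s
        exact ⟨g * k, (mul_smul g k x₀).trans (congrArg (g • ·) hk)⟩⟩
      one_smul := fun x => Subtype.ext (by
        change OnePoint.map (τ 1) x.1 = x.1
        rw [map_one]
        exact congrFun OnePoint.map_id x.1)
      mul_smul := fun s t x => Subtype.ext (by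
        change OnePoint.map (τ (s * t)) x.1 = OnePoint.map (τ s) (OnePoint.map (τ t) x.1)
        rw [map_mul]
        exact congrFun (OnePoint.map_comp (τ s) (τ t)) x.1) }
  have hfree : ∀ x : MulAction.orbit (GL (Fin 2) K) x₀, MulAction.stabilizer G x = ⊥ := by
    rintro ⟨_, g, rfl⟩
    rw [eq_bot_iff]
    intro s hs
    have h1 : OnePoint.map (τ s) (g • x₀) = g • x₀ := congrArg Subtype.val hs
    rw [hcomm] at h1
    have h2 : OnePoint.map (τ s) x₀ = x₀ := MulAction.injective g h1
    have h3 : τ s RatFunc.X = RatFunc.X := OnePoint.coe_injective h2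
    exact Subgroup.mem_bot.mpr
      (hτ ((RatFunc.algEquiv_eq_one_of_apply_X h3).trans (map_one τ).symm))
  have h1 : Nat.card G ∣ Nat.card (MulAction.orbit (GL (Fin 2) K) x₀) := by
    rw [Nat.card_congr (MulAction.selfEquivOrbitsQuotientProd hfree), Nat.card_prod]
    exact dvd_mul_left _ _
  refine h1.trans ?_
  rw [Nat.card_congr (MulAction.orbitEquivQuotientStabilizer (GL (Fin 2) K) x₀)]
  exact Subgroup.card_quotient_dvd_card _

/-- A finite group of automorphisms of a nontrivial subfield of `K(X)` embeds into that of `K(X)`,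
by Lüroth's theorem. -/
lemma card_dvd_card_GL_two_of_algHom_ratFunc {K F G : Type*} [Field K] [Finite K] [Field F]
    [Algebra K F] [Group G] [Finite G] [Nontrivial G] (φ : F →ₐ[K] RatFunc K)
    (τ : G →* (F ≃ₐ[K] F)) (hτ : Function.Injective τ) :
    Nat.card G ∣ Nat.card (GL (Fin 2) K) := by
  have hne : φ.fieldRange ≠ ⊥ := by
    intro h
    obtain ⟨g, hg⟩ := exists_ne (1 : G)
    refine hg (hτ ?_)
    rw [map_one]
    ext x
    have hx : φ x ∈ (⊥ : IntermediateField K (RatFunc K)) := h ▸ AlgHom.mem_fieldRange.mpr ⟨x, rfl⟩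
    obtain ⟨c, hc⟩ := IntermediateField.mem_bot.mp hx
    have : x = algebraMap K F c := φ.injective (hc.symm.trans (φ.commutes c).symm)
    rw [this, AlgEquiv.commutes, AlgEquiv.one_apply]
  let e : F ≃ₐ[K] RatFunc K :=
    (AlgEquiv.ofInjectiveField φ).trans (RatFunc.Luroth.algEquiv hne).symm
  exact RatFunc.card_dvd_card_GL_two (e.autCongr.toMonoidHom.comp τ)
    (e.autCongr.injective.comp hτ)

lemma le_of_prime_pow_dvd_card_GL_two {K : Type*} [Field K] [Finite K] {p r m : ℕ}
    (hp : p.Prime) (hm : 0 < m) (hK : Nat.card K = p ^ m) (h : p ^ r ∣ Nat.card (GL (Fin 2) K)) :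
    r ≤ m := by
  have := Fintype.ofFinite K
  rw [Matrix.card_GL_field, Fin.prod_univ_two, ← Nat.card_eq_fintype_card, hK] at h
  simp only [Fin.val_zero, Fin.val_one, pow_zero, pow_one] at h
  have hdvd : p ∣ p ^ m := dvd_pow_self p hm.ne'
  have hq1 : 1 ≤ p ^ m := Nat.one_le_pow _ _ hp.pos
  -- With `q = p ^ m`, `|GL₂(K)| = (q² - 1) q (q - 1)`, and only the factor `q` is divisible by `p`.
  have hco : ∀ k, 0 < k → Nat.Coprime (p ^ r) ((p ^ m) ^ k - 1) := by
    intro k hk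
    refine Nat.Coprime.pow_left _ ((Nat.Prime.coprime_iff_not_dvd hp).mpr fun hd => ?_)
    have h1 : p ∣ (p ^ m) ^ k := hdvd.trans (dvd_pow_self _ hk.ne')
    have h2 := (Nat.dvd_sub h1 hd)
    rw [Nat.sub_sub_self (Nat.one_le_pow _ _ hq1)] at h2
    exact hp.one_lt.ne' (Nat.dvd_one.mp h2)
  have h3 : (p ^ m) ^ 2 - p ^ m = p ^ m * ((p ^ m) ^ 1 - 1) := by
    rw [Nat.mul_sub, pow_one, mul_one, sq]
  rw [h3] at h
  exact (Nat.pow_dvd_pow_iff_le_right hp.one_lt).mp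
    ((hco 1 one_pos).dvd_of_dvd_mul_right ((hco 2 two_pos).dvd_of_dvd_mul_left h))

/-! ### The action on `K(V)` and Hilbert 90 -/

lemma polyAction_ι {K G V : Type*} [Field K] [Group G] [AddCommGroup V] [Module K V]
    (ρ : Representation K G V) (g : G) (f : Module.Dual K V) :
    polyAction ρ g (SymmetricAlgebra.ι K _ f) = SymmetricAlgebra.ι K _ (ρ.dual g f) :=
  SymmetricAlgebra.lift_ι_apply _ _

lemma functionFieldAction_injective {K G V : Type*} [Field K] [Group G] [AddCommGroup V]
    [Module K V] {ρ : Representation K G V} (hρ : Function.Injective ρ) :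
    Function.Injective (functionFieldAction ρ) := by
  refine (IsFractionRing.fieldEquivOfAlgEquivHom_injective K (SymmetricAlgebra K (Module.Dual K V))
    K (RationalFunctionField K V)).comp ?_
  rw [injective_iff_map_eq_one]
  intro g hg
  rw [← inv_eq_one]
  refine hρ ?_
  rw [map_one]
  ext v
  rw [Module.End.one_apply, ← sub_eq_zero, ← Module.forall_dual_apply_eq_zero_iff K]
  intro f
  have h := polyAction_ι ρ g f
  rw [hg, AlgEquiv.one_apply] at h
  -- Evaluating polynomials at `v` recovers `f (g⁻¹ v) = f v`.
  have h' := congrArg (SymmetricAlgebra.lift (Module.Dual.eval K V v)) h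
  rw [SymmetricAlgebra.lift_ι_apply, SymmetricAlgebra.lift_ι_apply] at h'
  rw [map_sub, sub_eq_zero]
  exact h'.symm

/-- Additive Hilbert 90 for homomorphisms into the ground field. -/
lemma exists_forall_apply_eq_add {K L G : Type*} [Field K] [Field L] [Algebra K L] [Group G]
    [Finite G] (σ : G →* (L ≃ₐ[K] L)) (hσ : Function.Injective σ) (c : G → K)
    (hc : ∀ g h, c (g * h) = c g + c h) :
    ∃ f : L, ∀ g, σ g f = f + algebraMap K L (c g) := by
  have := Fintype.ofFinite G
  -- By Dedekind's independence of characters, the trace is not identically zero.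
  obtain ⟨a, ha⟩ : ∃ a : L, ∑ g, σ g a ≠ 0 := by
    by_contra! h
    have hli := (linearIndependent_monoidHom L L).comp (fun g : G => ((σ g : L →* L)))
      (fun g h hgh => hσ (AlgEquiv.ext fun x => DFunLike.congr_fun hgh x))
    have h1 := Fintype.linearIndependent_iff.mp hli (fun _ => 1) (by
      ext x
      simpa using h x) 1
    exact one_ne_zero h1
  set T := ∑ g, σ g a with hT
  have hTinv : ∀ h, σ h T = T := fun h => by
    rw [hT, map_sum]
    exact Fintype.sum_equiv (Equiv.mulLeft h) _ _ fun g => by simp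
  refine ⟨-(∑ g, algebraMap K L (c g) * σ g a) / T, fun h => ?_⟩
  have h1 : σ h (∑ g, algebraMap K L (c g) * σ g a) =
      ∑ g, algebraMap K L (c g) * σ g a - algebraMap K L (c h) * T := by
    rw [map_sum, hT, Finset.mul_sum, ← Finset.sum_sub_distrib]
    refine Fintype.sum_equiv (Equiv.mulLeft h) _ _ fun g => ?_
    simp only [map_mul, AlgEquiv.commutes, Equiv.coe_mulLeft, hc, map_add, AlgEquiv.mul_apply]
    ring
  rw [map_div₀, map_neg, h1, hTinv]
  field_simp
  ring

open scoped IntermediateField.algebraAdjoinAdjoin in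
lemma IntermediateField.trdeg_adjoin_simple_le_one {K L : Type*} [Field K] [Field L] [Algebra K L]
    (f : L) : Algebra.trdeg K (IntermediateField.adjoin K {f}) ≤ 1 := by
  have h1 : Algebra.trdeg K (Algebra.adjoin K {f}) ≤ 1 := by
    have := lift_trdeg_le_of_surjective
      (Polynomial.aeval (R := K) (⟨f, Algebra.self_mem_adjoin_singleton K f⟩ :
        Algebra.adjoin K {f})) (by
      rintro ⟨x, hx⟩
      obtain ⟨P, rfl⟩ := (Algebra.adjoin_singleton_eq_range_aeval K f) ▸ hx
      refine ⟨P, Subtype.ext ?_⟩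
      rw [Polynomial.aeval_subalgebra_coe]
      rfl)
    rw [Polynomial.trdeg_of_isDomain] at this
    simpa using this
  have : Algebra.IsAlgebraic (Algebra.adjoin K {f}) (IntermediateField.adjoin K {f}) :=
    IsLocalization.isAlgebraic _ (nonZeroDivisors _)
  have h2 := trdeg_add_eq K (Algebra.adjoin K {f}) (A := IntermediateField.adjoin K {f})
  rw [trdeg_eq_zero (R := Algebra.adjoin K {f}), add_zero] at h2
  exact h2 ▸ h1

lemma IntermediateField.forall_mem_adjoin_apply_mem {K L : Type*} [Field K] [Field L] [Algebra K L]
    {S : Set L} {E : IntermediateField K L} (σ : L ≃ₐ[K] L) (h : ∀ x ∈ S, σ x ∈ E) :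
    ∀ x ∈ IntermediateField.adjoin K S, σ x ∈ E :=
  IntermediateField.adjoin_le_iff.mpr (show S ⊆ (E.comap σ.toAlgHom : Set L) from h)

/-! ### Faithful subfields and the two implications -/

lemma IsFaithfulGSubfield.exists_injective_hom {K G L : Type*} [Field K] [Group G] [Field L]
    [Algebra K L] {σ : G →* (L ≃ₐ[K] L)} {E : IntermediateField K L}
    (hE : IsFaithfulGSubfield σ E) :
    ∃ τ : G →* (E ≃ₐ[K] E), Function.Injective τ := by
  let τ₀ : G →* (E →ₐ[K] E) :=
    { toFun := fun g => ((σ g).toAlgHom.comp E.val).codRestrict E.toSubalgebra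
        fun x => hE.1 g x x.2
      map_one' := by
        ext x
        change σ 1 x.1 = x.1
        rw [map_one, AlgEquiv.one_apply]
      map_mul' := fun g h => by
        ext x
        change σ (g * h) x.1 = σ g (σ h x.1)
        rw [map_mul, AlgEquiv.mul_apply] }
  refine ⟨(AlgEquiv.algHomUnitsEquiv K E).toMonoidHom.comp τ₀.toHomUnits, ?_⟩
  rw [injective_iff_map_eq_one]
  intro g hg
  exact hE.2 g fun x hx => congrArg Subtype.val (DFunLike.congr_fun hg (⟨x, hx⟩ : E))

/-- For a finite group, a faithful `G`-subfield contains a finitely generated one. -/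
lemma IsFaithfulGSubfield.exists_finset_adjoin {K G L : Type*} [Field K] [Group G] [Finite G]
    [Field L] [Algebra K L] {σ : G →* (L ≃ₐ[K] L)} {E : IntermediateField K L}
    (hE : IsFaithfulGSubfield σ E) :
    ∃ S : Finset L, IntermediateField.adjoin K (S : Set L) ≤ E ∧
      IsFaithfulGSubfield σ (IntermediateField.adjoin K (S : Set L)) := by
  classical
  have := Fintype.ofFinite G
  have hex : ∀ g : G, ∃ x ∈ E, σ g x = x → g = 1 := by
    intro g
    by_contra! h
    exact (h 0 E.zero_mem).2 (hE.2 g fun x hx => (h x hx).1)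
  choose x hxE hx using hex
  -- Each `g ≠ 1` moves its witness `x g`; adjoining whole orbits makes the field stable.
  let S : Finset L := Finset.univ.image fun q : G × G => σ q.1 (x q.2)
  have hmem : ∀ g h, σ g (x h) ∈ IntermediateField.adjoin K (S : Set L) := fun g h =>
    IntermediateField.subset_adjoin K _
      (Finset.mem_coe.mpr (Finset.mem_image.mpr ⟨(g, h), Finset.mem_univ _, rfl⟩))
  refine ⟨S, IntermediateField.adjoin_le_iff.mpr ?_, fun g => ?_, fun g hg => ?_⟩
  · intro y hy
    obtain ⟨⟨g, h⟩, -, rfl⟩ := Finset.mem_image.mp (Finset.mem_coe.mp hy)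
    exact hE.1 g _ (hxE h)
  · refine IntermediateField.forall_mem_adjoin_apply_mem (σ g) fun y hy => ?_
    obtain ⟨⟨k, h⟩, -, rfl⟩ := Finset.mem_image.mp (Finset.mem_coe.mp hy)
    have := hmem (g * k) h
    rwa [map_mul, AlgEquiv.mul_apply] at this
  · refine hx g (hg _ ?_)
    simpa using hmem 1 g

lemma IsFaithfulGSubfield.ne_bot {K G L : Type*} [Field K] [Group G] [Nontrivial G]
    [Field L] [Algebra K L] {σ : G →* (L ≃ₐ[K] L)} {E : IntermediateField K L}
    (hE : IsFaithfulGSubfield σ E) : ¬ E ≤ ⊥ := by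
  intro h
  obtain ⟨g, hg⟩ := exists_ne (1 : G)
  refine hg (hE.2 g fun x hx => ?_)
  obtain ⟨c, rfl⟩ := IntermediateField.mem_bot.mp (h hx)
  exact (σ g).commutes c

lemma IsFaithfulGSubfield.one_le_trdeg {K G V : Type*} [Field K] [Group G] [Nontrivial G]
    [AddCommGroup V] [Module K V] [FiniteDimensional K V]
    {σ : G →* (RationalFunctionField K V ≃ₐ[K] RationalFunctionField K V)}
    {E : IntermediateField K (RationalFunctionField K V)} (hE : IsFaithfulGSubfield σ E) :
    1 ≤ Algebra.trdeg K E := by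
  rw [Cardinal.one_le_iff_ne_zero, Ne, trdeg_eq_zero_iff]
  intro halg
  exact hE.ne_bot fun x hx =>
    mem_bot_of_isAlgebraic ((halg.isAlgebraic (⟨x, hx⟩ : E)).algHom E.val)

lemma essentialDimension_eq_one {K G V : Type*} [Field K] [Group G] [Nontrivial G] [Finite G]
    [AddCommGroup V] [Module K V] [FiniteDimensional K V] {ρ : Representation K G V}
    (hρ : Function.Injective ρ) (c : G → K) (hc : ∀ g h, c (g * h) = c g + c h)
    (hc0 : ∀ g, c g = 0 → g = 1) : essentialDimension ρ = 1 := by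
  obtain ⟨f, hf⟩ := exists_forall_apply_eq_add (functionFieldAction ρ)
    (functionFieldAction_injective hρ) c hc
  have hfE := IntermediateField.mem_adjoin_simple_self K f
  have hE : IsFaithfulGSubfield (functionFieldAction ρ) (IntermediateField.adjoin K {f}) := by
    refine ⟨fun g => IntermediateField.forall_mem_adjoin_apply_mem _ ?_, fun g hg => hc0 g ?_⟩
    · rintro _ rfl
      rw [hf]
      exact add_mem hfE (IntermediateField.algebraMap_mem _ _)
    · simpa [hf] using hg f hfE
  have h1 := le_antisymm (IntermediateField.trdeg_adjoin_simple_le_one f) hE.one_le_trdeg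
  refine le_antisymm (csInf_le' ⟨_, hE, h1.symm⟩) (le_csInf ⟨1, _, hE, h1.symm⟩ ?_)
  rintro _ ⟨E, hE, rfl⟩
  exact hE.one_le_trdeg

lemma card_dvd_card_GL_two_of_essentialDimension_eq_one {K G V : Type*} [Field K] [Finite K]
    [Group G] [Nontrivial G] [Finite G] [AddCommGroup V] [Module K V] [FiniteDimensional K V]
    {ρ : Representation K G V} (h : essentialDimension ρ = 1) :
    Nat.card G ∣ Nat.card (GL (Fin 2) K) := by
  -- An empty set of cardinals has infimum 0, so the value 1 is attained.
  obtain ⟨E, hE, htr⟩ := csInf_mem (s := {d | ∃ E : IntermediateField K (RationalFunctionField K V),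
    IsFaithfulGSubfield (functionFieldAction ρ) E ∧ d = Algebra.trdeg K E}) (by
      rw [Set.nonempty_iff_ne_empty]
      intro h0
      rw [essentialDimension, h0, Cardinal.sInf_empty] at h
      exact zero_ne_one h)
  rw [show sInf _ = _ from h] at htr
  obtain ⟨S, hSE, hS⟩ := hE.exists_finset_adjoin
  obtain ⟨τ, hτ⟩ := hS.exists_injective_hom
  obtain ⟨φ⟩ := nonempty_algHom_ratFunc S (fun h0 => hS.ne_bot h0.le)
    ((trdeg_le_of_injective (IntermediateField.inclusion hSE)
      (IntermediateField.inclusion_injective hSE)).trans htr.ge)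
  exact card_dvd_card_GL_two_of_algHom_ratFunc φ τ hτ

theorem lemma2p7 {K V : Type*} [Field K] (p : ℕ) [Fact p.Prime] [CharP K p] [Algebra (ZMod p) K]
    (r : ℕ) (hr : 0 < r) [AddCommGroup V] [Module K V] [FiniteDimensional K V]
    (ρ : Representation K (Multiplicative (Fin r → ZMod p)) V) (hρ : Function.Injective ρ) :
    essentialDimension ρ = 1 ↔ (r : Cardinal) ≤ Module.rank (ZMod p) K := by
  have : Nonempty (Fin r) := ⟨⟨0, hr⟩⟩
  have hfin : Finite (Multiplicative (Fin r → ZMod p)) :=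
    inferInstanceAs (Finite (Fin r → ZMod p))
  have hnt : Nontrivial (Multiplicative (Fin r → ZMod p)) :=
    inferInstanceAs (Nontrivial (Fin r → ZMod p))
  constructor
  · intro h
    by_contra! hlt
    have : Module.Finite (ZMod p) K :=
      Module.rank_lt_aleph0_iff.mp (hlt.trans Cardinal.natCast_lt_aleph0)
    have : Finite K := Module.finite_of_finite (ZMod p)
    have hK : Nat.card K = p ^ Module.finrank (ZMod p) K := by
      rw [Module.natCard_eq_pow_finrank (K := ZMod p), Nat.card_zmod]
    have hdvd := card_dvd_card_GL_two_of_essentialDimension_eq_one h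
    have hG : Nat.card (Multiplicative (Fin r → ZMod p)) = p ^ r := by
      rw [Nat.card_congr Multiplicative.toAdd, Nat.card_fun, Nat.card_zmod, Nat.card_fin]
    rw [hG] at hdvd
    have hle := le_of_prime_pow_dvd_card_GL_two Fact.out Module.finrank_pos hK hdvd
    rw [← Module.finrank_eq_rank, Nat.cast_lt] at hlt
    omega
  · intro h
    obtain ⟨f, hf⟩ := Module.le_rank_iff_exists_linearMap.mp h
    refine essentialDimension_eq_one hρ (fun g => f g.toAdd) (fun g k => ?_) fun g hg => ?_
    · rw [toAdd_mul, map_add]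
    · exact Multiplicative.toAdd.injective (hf (by simpa using hg))
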